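/- Let $(\Omega,\mathcal F,\mathbb P)$ be a probability space, let $n\ge 0$ be an integer and let $p>1$ be real. Let $H_n$ denote the $n$th probabilists' Hermite polynomial ($H_0(x)=1$, $H_1(x)=x$, $H_2(x)=x^2-1$, …). Given a family $W=\{W(h)\}_{h\in\mathfrak H}$ of real random variables indexed by a real Hilbert space $\mathfrak H$, the homogeneous Wiener chaos $\mathcal H_n\subset L^2(\Omega,\mathcal F,\mathbb P)$ is the closed linear span of $\{H_n(W(h)) : h\in\mathfrak H,\ \|h\|_{\mathfrak H}=1\}$ if $n\ge1$, and the space of constants if $n=0$. Suppose that one of the following holds. (i) (Finite dimension.) $\mathfrak H=\mathbb R^N$ with its Euclidean inner product, and $W(h)=\sum_{i=1}^N h_iX_i$, where $X_1,\dots,X_N$ are independent standard Gaussian random variables. (ii) (Arbitrary, possibly infinite, dimension.) $\mathfrak H$ is a separable real Hilbert space and $W$ is an isonormal Gaussian process over $\mathfrak H$, that is, a centred, jointly Gaussian family with $\mathbb E[W(h_1)W(h_2)]=\langle h_1,h_2\rangle_{\mathfrak H}$ for all $h_1,h_2\in\mathfrak H$. Then every $F\in\mathcal H_n$ satisfies $\mathbb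 E[|F|^{2p}]<\infty$ and $$\mathbb E\bigl[|F|^{2p}\bigr]^{1/(2p)}\le (2p-1)^{n/2}\,\mathbb E\bigl[F^2\bigr]^{1/2}.$$ -/

import Mathlib

open MeasureTheory ProbabilityTheory
open scoped ENNReal

/-- The probabilists' Hermite polynomial of degree `n`, evaluated at a real number:
`1, x, x ^ 2 - 1, x ^ 3 - 3 * x, …`. -/
noncomputable def hermiteEval (n : ℕ) (x : ℝ) : ℝ :=
  Polynomial.aeval x (Polynomial.hermite n)

/-- The linear combination `W(h) = ∑ i, h i * X i` of the random variables `X i`,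
for `h` in `ℝ^N` with its Euclidean structure. -/
noncomputable def linearField {Ω : Type*} {N : ℕ} (X : Fin N → Ω → ℝ) :
    EuclideanSpace ℝ (Fin N) → Ω → ℝ :=
  fun h ω => ∑ i, h i * X i ω

/-- `W` is an isonormal Gaussian process over the real inner product space `H`: a centred,
jointly Gaussian family of random variables with `E[W(h₁) W(h₂)] = ⟨h₁, h₂⟩`. -/
structure IsIsonormal {Ω H : Type*} [MeasurableSpace Ω] [NormedAddCommGroup H]
    [InnerProductSpace ℝ H] (W : H → Ω → ℝ) (P : Measure Ω) : Prop where
  isGaussianProcess : IsGaussianProcess W P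
  centred : ∀ h, ∫ ω, W h ω ∂P = 0
  covariance : ∀ h₁ h₂, ∫ ω, W h₁ ω * W h₂ ω ∂P = inner ℝ h₁ h₂

/-- The homogeneous Wiener chaos of order `n` of the family `W`, as a subspace of `L²(P)`:
the constants for `n = 0`, and for `n ≥ 1` the closed linear span of the random variables
`Hₙ(W(h))` with `‖h‖ = 1` (the closure changes nothing when `H` has finite dimension). -/
noncomputable def wienerChaos {Ω H : Type*} [MeasurableSpace Ω] [NormedAddCommGroup H]
    (W : H → Ω → ℝ) (P : Measure Ω) : ℕ → Submodule ℝ (Lp ℝ 2 P)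
  | 0 => Submodule.span ℝ {F | ∃ c : ℝ, F =ᵐ[P] fun _ => c}
  | n + 1 => (Submodule.span ℝ {F : Lp ℝ 2 P | ∃ h : H, ‖h‖ = 1 ∧
      F =ᵐ[P] fun ω => hermiteEval (n + 1) (W h ω)}).topologicalClosure

/-! The proof rests on hypercontractivity of the Gaussian noise operator. Let `V` be standard
Gaussian in a finite-dimensional space, let `V'` be an independent copy and let `U = ρ V + √(1 - ρ²)
V'`. If `ρ² = r - 1` with `1 < r ≤ 2`, then `E[f(U) g(V)] ≤ ‖f‖₂ ‖g‖_r`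
(`lintegral_mul_stdGaussian_le`).

This bilinear inequality holds for a pair of `ρ`-correlated signs (`two_point_real`), passes to
independent sums with constant 1 (`IsHypercontractiveCoupling.conv`), and survives the central limit
theorem (`exists_tendsto_gaussianCoupling`).

By Mehler's formula (`integral_hermiteEval_affine`), noise multiplies a combination `F` of Hermite
polynomials of degree `n` by `ρ ^ n`. For `q = 2p`, take `r` conjugate to `q`, so that `ρ² = 1 / (q
- 1)`, and test with `f = |F|`, `g = |F| ^ (q - 1)`. This gives `ρ ^ n E|F|^q ≤ ‖F‖₂ ‖F‖_q ^ (q -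
1)`, and division yields the bound (`eLpNorm_hermiteSum_le`).

Only finitely many `W(h)` occur in such an `F`, and their joint law is that of coordinates of a
standard Gaussian vector (`IsIsonormal.map_eq_map_stdGaussian`). Fatou's lemma extends the bound to
the `L²` closure (`isClosed_setOf_eLpNorm_le`). -/

/-! ### The two-point inequality -/

/-- The mean of `(1 + b) ^ s` and `(1 - b) ^ s` is at least `1` for `s ≤ 0`. -/
lemma two_le_one_add_rpow_add_one_sub_rpow {s b : ℝ} (hs : s ≤ 0) (hb : |b| < 1) :
    2 ≤ (1 + b) ^ s + (1 - b) ^ s := by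
  obtain ⟨h1, h2⟩ := abs_lt.mp hb
  have hx : 0 < 1 + b := by linarith
  have hy : 0 < 1 - b := by linarith
  have hprod : 1 ≤ (1 + b) ^ s * (1 - b) ^ s := by
    rw [← Real.mul_rpow hx.le hy.le]
    exact Real.one_le_rpow_of_pos_of_le_one_of_nonpos (by positivity)
      (by nlinarith [sq_nonneg b]) hs
  have := Real.rpow_pos_of_pos hx s
  have := Real.rpow_pos_of_pos hy s
  nlinarith [sq_nonneg ((1 + b) ^ s - (1 - b) ^ s)]

/-- Twice the difference of the two sides vanishes with its derivative at 0. Its second derivative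
is `r (r - 1)` times `(1 + b) ^ (r - 2) + (1 - b) ^ (r - 2) - 2`, which is nonnegative as `r ≤ 2`.
Staying below `b = 1` keeps the bases positive. -/
lemma one_add_mul_sq_le_rpow_mean {r b : ℝ} (hr : 1 < r) (hr2 : r ≤ 2) (hb0 : 0 ≤ b)
    (hb : b < 1) :
    1 + r * (r - 1) / 2 * b ^ 2 ≤ ((1 + b) ^ r + (1 - b) ^ r) / 2 := by
  set D : Set ℝ := Set.Ico 0 1
  have hD : Convex ℝ D := convex_Ico 0 1
  have hint : interior D = Set.Ioo 0 1 := interior_Ico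
  have dplus (s x : ℝ) (hx : x ∈ Set.Ioo (-1 : ℝ) 1) :
      HasDerivAt (fun x : ℝ => (1 + x) ^ s) (s * (1 + x) ^ (s - 1)) x := by
    have := ((hasDerivAt_id x).const_add 1).rpow_const (p := s) (Or.inl (by simp; linarith [hx.1]))
    simpa using this
  have dminus (s x : ℝ) (hx : x ∈ Set.Ioo (-1 : ℝ) 1) :
      HasDerivAt (fun x : ℝ => (1 - x) ^ s) (-(s * (1 - x) ^ (s - 1))) x := by
    have := ((hasDerivAt_id x).const_sub 1).rpow_const (p := s) (Or.inl (by simp; linarith [hx.2]))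
    simpa using this
  have d1 (x : ℝ) (hx : x ∈ Set.Ioo (-1 : ℝ) 1) :
      HasDerivAt (fun x : ℝ => (1 + x) ^ r + (1 - x) ^ r - r * (r - 1) * x ^ 2)
        (r * ((1 + x) ^ (r - 1) - (1 - x) ^ (r - 1) - 2 * (r - 1) * x)) x := by
    convert! ((dplus r x hx).add (dminus r x hx)).sub
      ((hasDerivAt_pow 2 x).const_mul (r * (r - 1))) using 1
    simp; ring
  have d2 (x : ℝ) (hx : x ∈ Set.Ioo (-1 : ℝ) 1) :
      HasDerivAt (fun x : ℝ => (1 + x) ^ (r - 1) - (1 - x) ^ (r - 1) - 2 * (r - 1) * x)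
        ((r - 1) * ((1 + x) ^ (r - 2) + (1 - x) ^ (r - 2) - 2)) x := by
    convert! ((dplus (r - 1) x hx).sub (dminus (r - 1) x hx)).sub
      ((hasDerivAt_id x).const_mul (2 * (r - 1))) using 1
    simp only [show r - 1 - 1 = r - 2 by ring]; ring
  have sub : D ⊆ Set.Ioo (-1 : ℝ) 1 := fun x hx => ⟨by linarith [hx.1], hx.2⟩
  have mono2 : MonotoneOn
      (fun x : ℝ => (1 + x) ^ (r - 1) - (1 - x) ^ (r - 1) - 2 * (r - 1) * x) D := by
    refine monotoneOn_of_deriv_nonneg hD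
      (fun x hx => (d2 x (sub hx)).continuousAt.continuousWithinAt)
      (fun x hx => (d2 x (sub (interior_subset hx))).differentiableAt.differentiableWithinAt) ?_
    intro x hx
    have hx' := sub (interior_subset hx)
    rw [(d2 x hx').deriv]
    have := two_le_one_add_rpow_add_one_sub_rpow (s := r - 2) (b := x) (by linarith)
      (abs_lt.mpr hx')
    exact mul_nonneg (by linarith) (by linarith)
  have h0 : (0 : ℝ) ∈ D := by simp [D]
  have mono1 : MonotoneOn
      (fun x : ℝ => (1 + x) ^ r + (1 - x) ^ r - r * (r - 1) * x ^ 2) D := by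
    refine monotoneOn_of_deriv_nonneg hD
      (fun x hx => (d1 x (sub hx)).continuousAt.continuousWithinAt)
      (fun x hx => (d1 x (sub (interior_subset hx))).differentiableAt.differentiableWithinAt) ?_
    intro x hx
    have hxD := interior_subset hx
    rw [(d1 x (sub hxD)).deriv]
    have := mono2 h0 hxD hxD.1
    simp only [add_zero, sub_zero, Real.one_rpow, mul_zero, sub_self] at this
    exact mul_nonneg (by linarith) this
  have := mono1 h0 (show b ∈ D from ⟨hb0, hb⟩) hb0
  simp only [add_zero, sub_zero, Real.one_rpow] at this
  norm_num at this
  linarith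

lemma one_add_mul_sq_le_rpow_mean' {r b : ℝ} (hr : 1 < r) (hr2 : r ≤ 2) (hb : |b| ≤ 1) :
    1 + r * (r - 1) / 2 * b ^ 2 ≤ ((1 + b) ^ r + (1 - b) ^ r) / 2 := by
  have key : ∀ c ∈ Set.Icc (0 : ℝ) 1,
      1 + r * (r - 1) / 2 * c ^ 2 ≤ ((1 + c) ^ r + (1 - c) ^ r) / 2 := by
    have hcl : closure (Set.Ico (0 : ℝ) 1) = Set.Icc 0 1 := closure_Ico (by norm_num)
    intro c hc
    rw [← hcl] at hc
    have h1 : Continuous fun c : ℝ => (1 + c) ^ r :=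
      (continuous_const.add continuous_id).rpow_const fun _ => Or.inr (by linarith)
    have h2 : Continuous fun c : ℝ => (1 - c) ^ r :=
      (continuous_const.sub continuous_id).rpow_const fun _ => Or.inr (by linarith)
    exact closure_minimal (s := Set.Ico (0 : ℝ) 1)
      (t := {c | 1 + r * (r - 1) / 2 * c ^ 2 ≤ ((1 + c) ^ r + (1 - c) ^ r) / 2})
      (fun x hx => one_add_mul_sq_le_rpow_mean hr hr2 hx.1 hx.2)
      (isClosed_le (by fun_prop) ((h1.add h2).div_const 2)) hc
  have := key |b| ⟨abs_nonneg b, hb⟩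
  rcases abs_cases b with ⟨h, -⟩ | ⟨h, -⟩ <;> rw [h] at this
  · exact this
  · rw [neg_sq, ← sub_eq_add_neg, sub_neg_eq_add] at this
    linarith

/-- The two-point inequality: the noise operator contracts `L^r` into `L^2`. -/
lemma sqrt_sq_add_sq_le_rpow_mean {r a b : ℝ} (hr : 1 < r) (hr2 : r ≤ 2) (hab : |b| ≤ a) :
    √(a ^ 2 + (r - 1) * b ^ 2) ≤ (((a + b) ^ r + (a - b) ^ r) / 2) ^ (1 / r) := by
  have ha : 0 ≤ a := (abs_nonneg b).trans hab
  rcases ha.eq_or_lt with rfl | ha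
  · have : b = 0 := by simpa using hab
    subst this
    simp [show r ≠ 0 by linarith, show r⁻¹ ≠ 0 from inv_ne_zero (by linarith)]
  -- Both sides are homogeneous of degree 1, so only the ratio `c` matters.
  obtain ⟨c, rfl⟩ : ∃ c, b = a * c := ⟨b / a, by field_simp⟩
  have hc : |c| ≤ 1 := by
    rw [abs_mul, abs_of_pos ha] at hab
    exact le_of_mul_le_mul_left (by linarith) ha
  obtain ⟨hc1, hc2⟩ := abs_le.mp hc
  -- Bernoulli with exponent `r / 2 ≤ 1` produces `r (r - 1) / 2 * c ^ 2`, exactly the quadratic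
  -- term of the lower bound on the mean.
  have hbern := rpow_one_add_le_one_add_mul_self (s := (r - 1) * c ^ 2) (p := r / 2)
    (by nlinarith [sq_nonneg c]) (by linarith) (by linarith)
  have hm := one_add_mul_sq_le_rpow_mean' hr hr2 hc
  have hpos : 0 ≤ 1 + (r - 1) * c ^ 2 := by nlinarith [sq_nonneg c]
  have e1 : √(a ^ 2 + (r - 1) * (a * c) ^ 2) = a * ((1 + (r - 1) * c ^ 2) ^ (r / 2)) ^ (1 / r) := by
    rw [show a ^ 2 + (r - 1) * (a * c) ^ 2 = a ^ 2 * (1 + (r - 1) * c ^ 2) by ring,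
      Real.sqrt_mul (sq_nonneg a), Real.sqrt_sq ha.le, Real.sqrt_eq_rpow, ← Real.rpow_mul hpos]
    congr 2
    field_simp
  have hp1 := Real.rpow_nonneg (show 0 ≤ 1 + c by linarith) r
  have hp2 := Real.rpow_nonneg (show 0 ≤ 1 - c by linarith) r
  have e2 : (((a + a * c) ^ r + (a - a * c) ^ r) / 2) ^ (1 / r) =
      a * (((1 + c) ^ r + (1 - c) ^ r) / 2) ^ (1 / r) := by
    rw [show a + a * c = a * (1 + c) by ring, show a - a * c = a * (1 - c) by ring,
      Real.mul_rpow ha.le (by linarith), Real.mul_rpow ha.le (by linarith), ← mul_add, mul_div_assoc,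
      Real.mul_rpow (by positivity) (by linarith),
      ← Real.rpow_mul ha.le, mul_one_div_cancel (by linarith), Real.rpow_one]
  rw [e1, e2]
  gcongr
  linarith

/-- Two-point hypercontractivity for a pair of `ρ`-correlated signs, `ρ ^ 2 = r - 1`. -/
lemma two_point_real {r ρ f₁ f₂ g₁ g₂ : ℝ} (hr : 1 < r) (hr2 : r ≤ 2) (hρ : ρ ^ 2 = r - 1)
    (hg₁ : 0 ≤ g₁) (hg₂ : 0 ≤ g₂) :
    (1 + ρ) / 4 * (f₁ * g₁ + f₂ * g₂) + (1 - ρ) / 4 * (f₁ * g₂ + f₂ * g₁) ≤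
      ((f₁ ^ 2 + f₂ ^ 2) / 2) ^ (1 / 2 : ℝ) * ((g₁ ^ r + g₂ ^ r) / 2) ^ (1 / r) := by
  -- Split `g` into mean `u` and half-difference `v`; noise turns `u ± v` into `u ± ρ v`.
  -- Nonnegativity of `g` gives `|v| ≤ u`.
  have h := sqrt_sq_add_sq_le_rpow_mean (a := (g₁ + g₂) / 2) (b := (g₁ - g₂) / 2) hr hr2
    (abs_le.mpr ⟨by linarith, by linarith⟩)
  rw [show (g₁ + g₂) / 2 + (g₁ - g₂) / 2 = g₁ by ring,
    show (g₁ + g₂) / 2 - (g₁ - g₂) / 2 = g₂ by ring] at h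
  refine le_trans ?_ (mul_le_mul_of_nonneg_left h (by positivity))
  rw [← Real.sqrt_eq_rpow, ← Real.sqrt_mul (by positivity)]
  apply Real.le_sqrt_of_sq_le
  rw [← hρ]
  -- Cauchy–Schwarz for `(f₁, f₂)` and `(u + ρ v, u - ρ v)`; the square is its deficit.
  nlinarith [sq_nonneg (f₁ * ((g₁ + g₂) / 2 - ρ * ((g₁ - g₂) / 2)) -
    f₂ * ((g₁ + g₂) / 2 + ρ * ((g₁ - g₂) / 2)))]

/-- Infinite values are allowed because tensorization feeds partial integrals, possibly infinite,
back into the inequality. -/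
lemma two_point_ennreal {r ρ : ℝ} (hr : 1 < r) (hr2 : r ≤ 2) (hρ : ρ ^ 2 = r - 1)
    (hρ0 : 0 ≤ ρ) (hρ1 : ρ ≤ 1) (f₁ f₂ g₁ g₂ : ℝ≥0∞) :
    ENNReal.ofReal ((1 + ρ) / 4) * (f₁ * g₁ + f₂ * g₂) +
        ENNReal.ofReal ((1 - ρ) / 4) * (f₁ * g₂ + f₂ * g₁) ≤
      ((f₁ ^ (2 : ℝ) + f₂ ^ (2 : ℝ)) / 2) ^ (1 / 2 : ℝ) * ((g₁ ^ r + g₂ ^ r) / 2) ^ (1 / r) := by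
  have hr0 : 0 < r := by linarith
  by_cases hf : f₁ = 0 ∧ f₂ = 0
  · simp [hf.1, hf.2]
  by_cases hg : g₁ = 0 ∧ g₂ = 0
  · simp [hg.1, hg.2]
  have hfpos : ((f₁ ^ (2 : ℝ) + f₂ ^ (2 : ℝ)) / 2) ^ (1 / 2 : ℝ) ≠ 0 := by
    simp only [ne_eq, ENNReal.rpow_eq_zero_iff, ENNReal.div_eq_zero_iff, add_eq_zero]
    norm_num
    intro h; exact fun h' => hf ⟨h, h'⟩
  have hgpos : ((g₁ ^ r + g₂ ^ r) / 2) ^ (1 / r) ≠ 0 := by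
    simp only [ne_eq, ENNReal.rpow_eq_zero_iff, ENNReal.div_eq_zero_iff, add_eq_zero]
    have h1 : 0 < 1 / r := by positivity
    simp only [hr0, not_lt.mpr hr0.le, h1, not_lt.mpr h1.le, and_true, and_false, or_false]
    norm_num
    intro h; exact fun h' => hg ⟨h, h'⟩
  by_cases hft : f₁ = ∞ ∨ f₂ = ∞
  · have : ((f₁ ^ (2 : ℝ) + f₂ ^ (2 : ℝ)) / 2) ^ (1 / 2 : ℝ) = ∞ := by
      rcases hft with rfl | rfl <;> simp [ENNReal.top_div]
    rw [this, ENNReal.top_mul hgpos]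
    exact le_top
  by_cases hgt : g₁ = ∞ ∨ g₂ = ∞
  · have : ((g₁ ^ r + g₂ ^ r) / 2) ^ (1 / r) = ∞ := by
      rcases hgt with rfl | rfl <;> simp [ENNReal.top_div, hr0]
    rw [this, ENNReal.mul_top hfpos]
    exact le_top
  push Not at hft hgt
  lift f₁ to NNReal using hft.1
  lift f₂ to NNReal using hft.2
  lift g₁ to NNReal using hgt.1
  lift g₂ to NNReal using hgt.2
  have h := two_point_real (f₁ := f₁) (f₂ := f₂) hr hr2 hρ g₁.2 g₂.2
  have h' := ENNReal.ofReal_le_ofReal h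
  have hf₁ := f₁.2
  have hf₂ := f₂.2
  have hg₁ := g₁.2
  have hg₂ := g₂.2
  simp only [NNReal.val_eq_coe] at h' hf₁ hf₂ hg₁ hg₂
  have c1 : 0 ≤ (1 + ρ) / 4 := by linarith
  have c2 : 0 ≤ (1 - ρ) / 4 := by linarith
  rw [ENNReal.ofReal_add (by positivity) (by positivity), ENNReal.ofReal_mul c1,
    ENNReal.ofReal_mul c2, ENNReal.ofReal_mul (by positivity),
    ← ENNReal.ofReal_rpow_of_nonneg (by positivity) (by positivity),
    ← ENNReal.ofReal_rpow_of_nonneg (by positivity) (by positivity),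
    ENNReal.ofReal_div_of_pos two_pos, ENNReal.ofReal_div_of_pos two_pos,
    ENNReal.ofReal_add (by positivity) (by positivity),
    ENNReal.ofReal_add (by positivity) (by positivity),
    ENNReal.ofReal_add (by positivity) (by positivity),
    ENNReal.ofReal_add (by positivity) (by positivity),
    ← ENNReal.ofReal_rpow_of_nonneg (by positivity) (by positivity),
    ← ENNReal.ofReal_rpow_of_nonneg (by positivity) (by positivity)] at h'
  simpa [ENNReal.ofReal_mul, ENNReal.ofReal_pow, ENNReal.ofReal_coe_nnreal] using h'

/-! ### Scalar asymptotics for the central limit theorem -/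

open Filter Topology in
lemma tendsto_mul_cos_div_sqrt_sub_one (u : ℝ) :
    Tendsto (fun n : ℕ => (n : ℝ) * (Real.cos (u / √n) - 1)) atTop (𝓝 (-(u ^ 2 / 2))) := by
  have hlim : Tendsto (fun n : ℕ => |u| ^ 4 * (5 / 96) / (n : ℝ)) atTop (𝓝 0) :=
    tendsto_const_div_atTop_nhds_zero_nat _
  have h0 : Tendsto (fun n : ℕ => u / √(n : ℝ)) atTop (𝓝 0) :=
    tendsto_const_nhds.div_atTop (Real.tendsto_sqrt_atTop.comp tendsto_natCast_atTop_atTop)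
  have hsmall : ∀ᶠ n : ℕ in atTop, |u / √(n : ℝ)| ≤ 1 := by
    have := h0.eventually (Metric.ball_mem_nhds (0 : ℝ) one_pos)
    filter_upwards [this] with n hn
    exact (mem_ball_zero_iff.mp hn).le
  refine tendsto_iff_norm_sub_tendsto_zero.mpr
    (squeeze_zero' (Eventually.of_forall fun _ => norm_nonneg _) ?_ hlim)
  filter_upwards [hsmall, eventually_gt_atTop 0] with n hn hn0
  -- The remainder of the cosine is of fourth order, with the constant `5 / 96`; at scale `1 / √n`
  -- it remains `O(1 / n)` after multiplication by `n`.
  have hb := Real.cos_bound hn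
  have hnpos : (0 : ℝ) < n := by exact_mod_cast hn0
  have e2 : (u / √(n : ℝ)) ^ 2 = u ^ 2 / n := by rw [div_pow, Real.sq_sqrt hnpos.le]
  have e4 : |u / √(n : ℝ)| ^ 4 = |u| ^ 4 / n ^ 2 := by
    rw [abs_div, div_pow, abs_of_nonneg (Real.sqrt_nonneg _),
      show √(n : ℝ) ^ 4 = (√(n : ℝ) ^ 2) ^ 2 by ring, Real.sq_sqrt hnpos.le]
  rw [e2, e4] at hb
  have : (n : ℝ) * (Real.cos (u / √n) - 1) - -(u ^ 2 / 2) =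
      n * (Real.cos (u / √n) - (1 - u ^ 2 / n / 2)) := by
    field_simp; ring
  rw [this, norm_mul, Real.norm_eq_abs, Real.norm_eq_abs, abs_of_pos hnpos]
  calc (n : ℝ) * |Real.cos (u / √n) - (1 - u ^ 2 / n / 2)|
      ≤ n * (|u| ^ 4 / n ^ 2 * (5 / 96)) := by gcongr
    _ = |u| ^ 4 * (5 / 96) / n := by field_simp

-- The weights sum to 1, so the base is `1 + O(1 / n)` and the compound-interest limit applies. The
-- base is the characteristic function of a pair of correlated signs at scale `1 / √n`.
open Filter Topology in
lemma tendsto_cos_mix_pow (ρ u v : ℝ) :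
    Tendsto (fun n : ℕ => ((1 + ρ) / 2 * Real.cos (u / √n) + (1 - ρ) / 2 * Real.cos (v / √n)) ^ n)
      atTop (𝓝 (Real.exp (-((1 + ρ) / 4 * u ^ 2 + (1 - ρ) / 4 * v ^ 2)))) := by
  have h := ((tendsto_mul_cos_div_sqrt_sub_one u).const_mul ((1 + ρ) / 2)).add
    ((tendsto_mul_cos_div_sqrt_sub_one v).const_mul ((1 - ρ) / 2))
  have := Real.tendsto_one_add_pow_exp_of_tendsto
    (g := fun n : ℕ => (1 + ρ) / 2 * (Real.cos (u / √n) - 1) + (1 - ρ) / 2 * (Real.cos (v / √n) - 1))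
    (h.congr fun n => by ring)
  convert! this using 2
  · ring
  · congr 1; ring

/-! ### Hypercontractive couplings and convolution -/

section Coupling

variable {S : Type*} [NormedAddCommGroup S] [InnerProductSpace ℝ S] [FiniteDimensional ℝ S]
  [MeasurableSpace S] [BorelSpace S]

/-- A coupling of two random vectors such that
`E[f(U) g(V)] ≤ E[f(U) ^ 2] ^ (1 / 2) * E[g(V) ^ r] ^ (1 / r)` for all measurable `f, g ≥ 0`. -/
def IsHypercontractiveCoupling (r : ℝ) (μ : Measure (WithLp 2 (S × S))) : Prop :=
  ∀ f g : S → ℝ≥0∞, Measurable f → Measurable g →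
    ∫⁻ z, f z.fst * g z.snd ∂μ ≤
      (∫⁻ z, f z.fst ^ (2 : ℝ) ∂μ) ^ (1 / 2 : ℝ) * (∫⁻ z, g z.snd ^ r ∂μ) ^ (1 / r)

lemma measurable_withLp_fst : Measurable fun z : WithLp 2 (S × S) => z.fst :=
  (by fun_prop : Continuous fun z : WithLp 2 (S × S) => z.fst).measurable

lemma measurable_withLp_snd : Measurable fun z : WithLp 2 (S × S) => z.snd :=
  (by fun_prop : Continuous fun z : WithLp 2 (S × S) => z.snd).measurable

/-- Fix the first summand `x` and apply the inequality for `ν` to the translates of `f` and `g`. The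
resulting partial norms depend on `x.fst` and `x.snd` alone, so the inequality for `μ` applies to
them. -/
lemma IsHypercontractiveCoupling.conv {r : ℝ} (hr : 0 < r) {μ ν : Measure (WithLp 2 (S × S))}
    [SFinite μ] [SFinite ν] (hμ : IsHypercontractiveCoupling r μ)
    (hν : IsHypercontractiveCoupling r ν) : IsHypercontractiveCoupling r (μ ∗ ν) := by
  intro f g hf hg
  have m1 : Measurable fun z : WithLp 2 (S × S) => f z.fst := hf.comp measurable_withLp_fst
  have m2 : Measurable fun z : WithLp 2 (S × S) => g z.snd := hg.comp measurable_withLp_snd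
  have m12 : Measurable fun z : WithLp 2 (S × S) => f z.fst * g z.snd := m1.mul m2
  have mp1 : Measurable fun q : S × WithLp 2 (S × S) => f (q.1 + q.2.fst) :=
    hf.comp (measurable_fst.add (measurable_withLp_fst.comp measurable_snd))
  have mp2 : Measurable fun q : S × WithLp 2 (S × S) => g (q.1 + q.2.snd) :=
    hg.comp (measurable_fst.add (measurable_withLp_snd.comp measurable_snd))
  have mF : Measurable fun a : S => (∫⁻ y, f (a + y.fst) ^ (2 : ℝ) ∂ν) ^ (1 / 2 : ℝ) :=
    (Measurable.lintegral_prod_right (mp1.pow_const (2 : ℝ))).pow_const _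
  have mG : Measurable fun a : S => (∫⁻ y, g (a + y.snd) ^ r ∂ν) ^ (1 / r) :=
    (Measurable.lintegral_prod_right (mp2.pow_const r)).pow_const _
  rw [Measure.lintegral_conv m12, Measure.lintegral_conv (m1.pow_const _),
    Measure.lintegral_conv (m2.pow_const _)]
  have h1 := hμ _ _ mF mG
  simp only [← ENNReal.rpow_mul] at h1
  rw [show (1 / 2 : ℝ) * 2 = 1 by norm_num, show 1 / r * r = 1 by field_simp] at h1
  simp only [ENNReal.rpow_one] at h1
  refine le_trans (lintegral_mono fun x => ?_) h1
  exact hν (fun b => f (x.fst + b)) (fun b => g (x.snd + b)) (hf.comp (measurable_const_add _))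
    (hg.comp (measurable_const_add _))

open WithLp in
/-- The law of `(ε A, η A)` where `ε, η` are random signs with correlation `ρ`. -/
noncomputable def signCoupling (ρ : ℝ) (A : S) : Measure (WithLp 2 (S × S)) :=
  ENNReal.ofReal ((1 + ρ) / 4) •
    (Measure.dirac (toLp 2 (A, A)) + Measure.dirac (toLp 2 (-A, -A))) +
  ENNReal.ofReal ((1 - ρ) / 4) •
    (Measure.dirac (toLp 2 (A, -A)) + Measure.dirac (toLp 2 (-A, A)))

lemma ofReal_add_ofReal_eq_half {ρ : ℝ} (hρ0 : 0 ≤ ρ) (hρ1 : ρ ≤ 1) :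
    ENNReal.ofReal ((1 + ρ) / 4) + ENNReal.ofReal ((1 - ρ) / 4) = 2⁻¹ := by
  rw [← ENNReal.ofReal_add (by linarith) (by linarith), show (1 + ρ) / 4 + (1 - ρ) / 4 = 2⁻¹ by ring,
    ENNReal.ofReal_inv_of_pos two_pos, ENNReal.ofReal_ofNat]

lemma lintegral_signCoupling (ρ : ℝ) (A : S) {F : WithLp 2 (S × S) → ℝ≥0∞} (hF : Measurable F) :
    ∫⁻ z, F z ∂signCoupling ρ A =
      ENNReal.ofReal ((1 + ρ) / 4) * (F (WithLp.toLp 2 (A, A)) + F (WithLp.toLp 2 (-A, -A))) +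
      ENNReal.ofReal ((1 - ρ) / 4) * (F (WithLp.toLp 2 (A, -A)) + F (WithLp.toLp 2 (-A, A))) := by
  simp [signCoupling, lintegral_add_measure, lintegral_smul_measure, lintegral_dirac' _ hF, mul_add]

lemma isHypercontractiveCoupling_signCoupling {r ρ : ℝ} (hr : 1 < r) (hr2 : r ≤ 2)
    (hρ : ρ ^ 2 = r - 1) (hρ0 : 0 ≤ ρ) (hρ1 : ρ ≤ 1) (A : S) :
    IsHypercontractiveCoupling r (signCoupling ρ A) := by
  intro f g hf hg
  have m1 : Measurable fun z : WithLp 2 (S × S) => f z.fst := hf.comp measurable_withLp_fst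
  have m2 : Measurable fun z : WithLp 2 (S × S) => g z.snd := hg.comp measurable_withLp_snd
  have m12 : Measurable fun z : WithLp 2 (S × S) => f z.fst * g z.snd := m1.mul m2
  rw [lintegral_signCoupling _ _ m12, lintegral_signCoupling _ _ (m1.pow_const _),
    lintegral_signCoupling _ _ (m2.pow_const _)]
  refine (two_point_ennreal hr hr2 hρ hρ0 hρ1 (f A) (f (-A)) (g A) (g (-A))).trans_eq ?_
  simp only [WithLp.toLp_fst, WithLp.toLp_snd]
  rw [add_comm (g (-A) ^ r) (g A ^ r), ← add_mul, ← add_mul, ofReal_add_ofReal_eq_half hρ0 hρ1,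
    ENNReal.div_eq_inv_mul, ENNReal.div_eq_inv_mul]

lemma isProbabilityMeasure_signCoupling {ρ : ℝ} (hρ0 : 0 ≤ ρ) (hρ1 : ρ ≤ 1) (A : S) :
    IsProbabilityMeasure (signCoupling ρ A) := by
  constructor
  rw [← lintegral_one, lintegral_signCoupling _ _ measurable_const, ← add_mul,
    ofReal_add_ofReal_eq_half hρ0 hρ1, one_add_one_eq_two, ENNReal.inv_mul_cancel] <;> simp

lemma charFun_signCoupling {ρ : ℝ} (hρ0 : 0 ≤ ρ) (hρ1 : ρ ≤ 1) (A : S)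
    (t : WithLp 2 (S × S)) :
    charFun (signCoupling ρ A) t =
      (((1 + ρ) / 2 * Real.cos (inner ℝ A (t.fst + t.snd)) +
        (1 - ρ) / 2 * Real.cos (inner ℝ A (t.fst - t.snd)) : ℝ) : ℂ) := by
  have hi : ∀ ν : Measure (WithLp 2 (S × S)), IsFiniteMeasure ν →
      Integrable (fun x => Complex.exp (inner ℝ x t * Complex.I)) ν := fun ν _ =>
    (integrable_const (1 : ℝ)).mono (by fun_prop)
      (Filter.Eventually.of_forall fun x => by rw [Complex.norm_exp_ofReal_mul_I, norm_one])
  rw [charFun_apply, signCoupling]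
  rw [integral_add_measure ((hi _ inferInstance).smul_measure ENNReal.ofReal_ne_top)
    ((hi _ inferInstance).smul_measure ENNReal.ofReal_ne_top), integral_smul_measure,
    integral_smul_measure, integral_add_measure (hi _ inferInstance) (hi _ inferInstance),
    integral_add_measure (hi _ inferInstance) (hi _ inferInstance)]
  simp only [integral_dirac, WithLp.prod_inner_apply, inner_neg_left, inner_add_right,
    inner_sub_right]
  rw [ENNReal.toReal_ofReal (by linarith), ENNReal.toReal_ofReal (by linarith),
    show t.ofLp.1 = t.fst from rfl, show t.ofLp.2 = t.snd from rfl]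
  simp only [Complex.real_smul, Complex.ofReal_add, Complex.ofReal_mul, Complex.ofReal_cos,
    Complex.cos]
  push_cast
  ring_nf

end Coupling

/-! ### Passage to the Gaussian coupling -/

section GaussianCoupling

variable {S : Type*} [NormedAddCommGroup S] [InnerProductSpace ℝ S] [FiniteDimensional ℝ S]
  [MeasurableSpace S] [BorelSpace S]

variable (S) in
/-- Characteristic functions of hypercontractive couplings. -/
noncomputable def couplingCharFuns (r : ℝ) (hr : 0 < r) : Submonoid (WithLp 2 (S × S) → ℂ) where
  carrier := {φ | ∃ μ : Measure (WithLp 2 (S × S)), IsProbabilityMeasure μ ∧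
    IsHypercontractiveCoupling r μ ∧ charFun μ = φ}
  mul_mem' := by
    rintro _ _ ⟨μ, h1, h2, rfl⟩ ⟨ν, h3, h4, rfl⟩
    exact ⟨μ ∗ ν, inferInstance, h2.conv hr h4, funext fun t => charFun_conv t⟩
  one_mem' := by
    refine ⟨Measure.dirac 0, inferInstance, fun f g hf hg => ?_, ?_⟩
    · have m1 : Measurable fun z : WithLp 2 (S × S) => f z.fst := hf.comp measurable_withLp_fst
      have m2 : Measurable fun z : WithLp 2 (S × S) => g z.snd := hg.comp measurable_withLp_snd
      have m12 : Measurable fun z : WithLp 2 (S × S) => f z.fst * g z.snd := m1.mul m2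
      rw [lintegral_dirac' _ m12, lintegral_dirac' _ (m1.pow_const _),
        lintegral_dirac' _ (m2.pow_const _), ← ENNReal.rpow_mul, ← ENNReal.rpow_mul,
        mul_one_div_cancel two_ne_zero, mul_one_div_cancel hr.ne', ENNReal.rpow_one,
        ENNReal.rpow_one]
    · ext t; simp [charFun_dirac]

open WithLp in
/-- The law of `(ρ X + √(1 - ρ²) Y, X)` for independent standard Gaussian vectors `X, Y`. -/
noncomputable def gaussianCoupling (S : Type*) [NormedAddCommGroup S] [InnerProductSpace ℝ S]
    [FiniteDimensional ℝ S] [MeasurableSpace S] [BorelSpace S] (ρ : ℝ) :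
    Measure (WithLp 2 (S × S)) :=
  ((stdGaussian S).prod (stdGaussian S)).map
    fun q => toLp 2 (ρ • q.1 + √(1 - ρ ^ 2) • q.2, q.1)

lemma measurable_gaussianCoupling_map (ρ : ℝ) : Measurable fun q : S × S =>
    WithLp.toLp 2 (ρ • q.1 + √(1 - ρ ^ 2) • q.2, q.1) :=
  (by fun_prop : Continuous _).measurable

instance (ρ : ℝ) : IsProbabilityMeasure (gaussianCoupling S ρ) :=
  Measure.isProbabilityMeasure_map (measurable_gaussianCoupling_map ρ).aemeasurable

/-- The covariance form is polarized into `t.fst ± t.snd` so as to match the limit of the sign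
couplings. -/
lemma charFun_gaussianCoupling {ρ : ℝ} (hρ : ρ ^ 2 ≤ 1) (t : WithLp 2 (S × S)) :
    charFun (gaussianCoupling S ρ) t =
      (Real.exp (-((1 + ρ) / 4 * ‖t.fst + t.snd‖ ^ 2 + (1 - ρ) / 4 * ‖t.fst - t.snd‖ ^ 2)) : ℂ) := by
  have h : charFun (gaussianCoupling S ρ) t = charFun (stdGaussian S) (ρ • t.fst + t.snd) *
      charFun (stdGaussian S) (√(1 - ρ ^ 2) • t.fst) := by
    rw [charFun_apply, gaussianCoupling, integral_map
      (measurable_gaussianCoupling_map ρ).aemeasurable (by fun_prop), charFun_apply, charFun_apply,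
      ← integral_prod_mul]
    refine integral_congr_ae (Filter.Eventually.of_forall fun q => ?_)
    simp only [WithLp.prod_inner_apply]
    rw [← Complex.exp_add, ← add_mul, show t.ofLp.1 = t.fst from rfl,
      show t.ofLp.2 = t.snd from rfl]
    congr 2
    rw [← Complex.ofReal_add]
    congr 1
    simp only [inner_add_left, inner_add_right, real_inner_smul_left, real_inner_smul_right]
    ring
  rw [h, charFun_stdGaussian, charFun_stdGaussian, ← Complex.exp_add, Complex.ofReal_exp]
  congr 1
  norm_cast
  rw [norm_smul, mul_pow, Real.norm_eq_abs, sq_abs, Real.sq_sqrt (by linarith), norm_add_sq_real,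
    norm_add_sq_real, norm_sub_sq_real, norm_smul, mul_pow, Real.norm_eq_abs, sq_abs,
    real_inner_smul_left]
  ring

-- Central limit theorem: for each vector of an orthonormal basis, add `n` independent sign
-- couplings of size `1 / √n`, then use Lévy's continuity theorem.
open Filter Topology in
lemma exists_tendsto_gaussianCoupling {r ρ : ℝ} (hr : 1 < r) (hr2 : r ≤ 2)
    (hρ : ρ ^ 2 = r - 1) (hρ0 : 0 ≤ ρ) (hρ1 : ρ ≤ 1) :
    ∃ μ : ℕ → ProbabilityMeasure (WithLp 2 (S × S)),
      (∀ n, IsHypercontractiveCoupling r (μ n : Measure (WithLp 2 (S × S)))) ∧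
      Tendsto μ atTop (𝓝 ⟨gaussianCoupling S ρ, inferInstance⟩) := by
  have hr0 : 0 < r := by linarith
  let b := stdOrthonormalBasis ℝ S
  let φ : ℕ → WithLp 2 (S × S) → ℂ := fun n =>
    ∏ i, charFun (signCoupling ρ ((√(n : ℝ))⁻¹ • b i)) ^ n
  have hsign : ∀ A : S, charFun (signCoupling ρ A) ∈ couplingCharFuns S r hr0 := fun A =>
    ⟨_, isProbabilityMeasure_signCoupling hρ0 hρ1 A,
      isHypercontractiveCoupling_signCoupling hr hr2 hρ hρ0 hρ1 A, rfl⟩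
  -- Products of characteristic functions correspond to convolutions, so closure of the submonoid
  -- supplies a hypercontractive coupling for each `n`.
  have hφ : ∀ n, φ n ∈ couplingCharFuns S r hr0 := fun n =>
    Submonoid.prod_mem _ fun i _ => Submonoid.pow_mem _ (hsign _) _
  choose μ hμ hμ2 hμ3 using hφ
  refine ⟨fun n => ⟨μ n, hμ n⟩, hμ2, ProbabilityMeasure.tendsto_iff_tendsto_charFun.2 fun t => ?_⟩
  have hlim : ∀ i, Tendsto (fun n : ℕ => (charFun (signCoupling ρ ((√(n : ℝ))⁻¹ • b i)) ^ n) t)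
      atTop (𝓝 (Real.exp (-((1 + ρ) / 4 * inner ℝ (b i) (t.fst + t.snd) ^ 2 +
        (1 - ρ) / 4 * inner ℝ (b i) (t.fst - t.snd) ^ 2)) : ℂ)) := by
    intro i
    have := (Complex.continuous_ofReal.tendsto _).comp
      (tendsto_cos_mix_pow ρ (inner ℝ (b i) (t.fst + t.snd)) (inner ℝ (b i) (t.fst - t.snd)))
    refine this.congr fun n => ?_
    simp only [Function.comp, Pi.pow_apply]
    rw [charFun_signCoupling hρ0 hρ1, real_inner_smul_left, real_inner_smul_left,
      Complex.ofReal_pow, div_eq_inv_mul (inner ℝ _ _), div_eq_inv_mul (inner ℝ _ _)]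
  have hprod := tendsto_finsetProd Finset.univ fun i _ => hlim i
  have e : charFun (gaussianCoupling S ρ) t = ∏ i,
      (Real.exp (-((1 + ρ) / 4 * inner ℝ (b i) (t.fst + t.snd) ^ 2 +
        (1 - ρ) / 4 * inner ℝ (b i) (t.fst - t.snd) ^ 2)) : ℂ) := by
    rw [charFun_gaussianCoupling (by linarith), ← Complex.ofReal_prod, ← Real.exp_sum,
      Finset.sum_neg_distrib, Finset.sum_add_distrib, ← Finset.mul_sum, ← Finset.mul_sum,
      b.sum_sq_inner_right, b.sum_sq_inner_right]
  change Tendsto (fun n => charFun (μ n) t) atTop (𝓝 (charFun (gaussianCoupling S ρ) t))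
  rw [e]
  refine hprod.congr fun n => ?_
  rw [hμ3 n]
  exact (Finset.prod_apply t Finset.univ _).symm

open Filter Topology NNReal in
lemma ProbabilityMeasure.tendsto_lintegral_of_le {E : Type*} [TopologicalSpace E]
    [MeasurableSpace E] [OpensMeasurableSpace E] {μ : ℕ → ProbabilityMeasure E}
    {ν : ProbabilityMeasure E} (h : Tendsto μ atTop (𝓝 ν)) {F : E → ℝ≥0} (hF : Continuous F)
    {C : ℝ≥0} (hC : ∀ x, F x ≤ C) :
    Tendsto (fun n => ∫⁻ x, F x ∂(μ n : Measure E)) atTop (𝓝 (∫⁻ x, F x ∂(ν : Measure E))) :=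
  ProbabilityMeasure.tendsto_iff_forall_lintegral_tendsto.mp h
    (BoundedContinuousFunction.mkOfBound ⟨F, hF⟩ C fun x y => by
      rw [NNReal.dist_eq]
      have h1 : (F x : ℝ) ≤ C := hC x
      have h2 : (F y : ℝ) ≤ C := hC y
      have h3 := (F x).coe_nonneg
      have h4 := (F y).coe_nonneg
      exact abs_le.mpr (by constructor <;> simp only [ContinuousMap.coe_mk] <;> linarith))

-- Weak convergence controls only bounded continuous integrands; hence the restriction.
open Filter Topology NNReal in
lemma lintegral_gaussianCoupling_le_of_bounded {r ρ : ℝ} (hr : 1 < r) (hr2 : r ≤ 2)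
    (hρ : ρ ^ 2 = r - 1) (hρ0 : 0 ≤ ρ) (hρ1 : ρ ≤ 1) {f g : S → ℝ≥0} (hf : Continuous f)
    (hg : Continuous g) {C : ℝ≥0} (hfC : ∀ x, f x ≤ C) (hgC : ∀ x, g x ≤ C) :
    ∫⁻ z, f z.fst * g z.snd ∂gaussianCoupling S ρ ≤
      (∫⁻ z, (f z.fst : ℝ≥0∞) ^ (2 : ℝ) ∂gaussianCoupling S ρ) ^ (1 / 2 : ℝ) *
      (∫⁻ z, (g z.snd : ℝ≥0∞) ^ r ∂gaussianCoupling S ρ) ^ (1 / r) := by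
  have hr0 : 0 ≤ r := by linarith
  obtain ⟨μ, hμ, hlim⟩ := exists_tendsto_gaussianCoupling (S := S) hr hr2 hρ hρ0 hρ1
  have cf : Continuous fun z : WithLp 2 (S × S) => f z.fst := hf.comp (by fun_prop)
  have cg : Continuous fun z : WithLp 2 (S × S) => g z.snd := hg.comp (by fun_prop)
  have l1 := ProbabilityMeasure.tendsto_lintegral_of_le hlim (cf.mul cg) (C := C * C)
    fun z => mul_le_mul' (hfC _) (hgC _)
  have l2 := ProbabilityMeasure.tendsto_lintegral_of_le hlim
    ((NNReal.continuous_rpow_const (y := (2 : ℝ)) (by norm_num)).comp cf) (C := C ^ (2 : ℝ))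
    fun z => NNReal.rpow_le_rpow (hfC _) (by norm_num)
  have l3 := ProbabilityMeasure.tendsto_lintegral_of_le hlim
    ((NNReal.continuous_rpow_const hr0).comp cg) (C := C ^ r)
    fun z => NNReal.rpow_le_rpow (hgC _) hr0
  simp only [ENNReal.coe_rpow_of_nonneg _ hr0,
    ENNReal.coe_rpow_of_nonneg _ (show (0 : ℝ) ≤ 2 by norm_num), Function.comp_apply] at l1 l2 l3
  -- Multiplication on `ℝ≥0∞` is discontinuous at `0 * ∞`; finite limits exclude that case.
  have fin2 : ∫⁻ z, (f z.fst : ℝ≥0∞) ^ (2 : ℝ) ∂gaussianCoupling S ρ ≠ ∞ := by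
    refine ne_top_of_le_ne_top ?_ (lintegral_mono (g := fun _ => (C : ℝ≥0∞) ^ (2 : ℝ)) fun z => ?_)
    · simp
    · exact ENNReal.rpow_le_rpow (by exact_mod_cast hfC _) (by norm_num)
  have fin3 : ∫⁻ z, (g z.snd : ℝ≥0∞) ^ r ∂gaussianCoupling S ρ ≠ ∞ := by
    refine ne_top_of_le_ne_top ?_ (lintegral_mono (g := fun _ => (C : ℝ≥0∞) ^ r) fun z => ?_)
    · simp [hr0]
    · exact ENNReal.rpow_le_rpow (by exact_mod_cast hgC _) hr0
  refine le_of_tendsto_of_tendsto' l1 (ENNReal.Tendsto.mul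
    (((ENNReal.continuous_rpow_const (y := (1 / 2 : ℝ))).tendsto _).comp l2)
    (Or.inr (ENNReal.rpow_ne_top_of_nonneg (by positivity) fin3))
    (((ENNReal.continuous_rpow_const (y := 1 / r)).tendsto _).comp l3)
    (Or.inr (ENNReal.rpow_ne_top_of_nonneg (by positivity) fin2))) fun n => ?_
  exact hμ n (fun x => f x) (fun x => g x) hf.measurable.coe_nnreal_ennreal
    hg.measurable.coe_nnreal_ennreal

lemma map_fst_gaussianCoupling {ρ : ℝ} (hρ : ρ ^ 2 ≤ 1) :
    (gaussianCoupling S ρ).map (fun z => z.fst) = stdGaussian S := by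
  apply Measure.ext_of_charFun
  ext t
  have h := charFun_gaussianCoupling hρ (WithLp.toLp 2 (t, (0 : S)))
  rw [charFun_apply] at h
  rw [charFun_apply, integral_map measurable_withLp_fst.aemeasurable (by fun_prop),
    charFun_stdGaussian]
  simp only [WithLp.prod_inner_apply, inner_zero_right, add_zero, WithLp.toLp_fst, WithLp.toLp_snd,
    sub_zero] at h
  refine h.trans ?_
  rw [Complex.ofReal_exp]
  congr 1
  push_cast
  ring

lemma map_snd_gaussianCoupling (ρ : ℝ) :
    (gaussianCoupling S ρ).map (fun z => z.snd) = stdGaussian S := by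
  rw [gaussianCoupling, Measure.map_map measurable_withLp_snd (measurable_gaussianCoupling_map ρ)]
  exact measurePreserving_fst.map_eq

open Filter Topology NNReal in
/-- Gaussian hypercontractivity in its bilinear form. -/
theorem lintegral_mul_stdGaussian_le {r ρ : ℝ} (hr : 1 < r) (hr2 : r ≤ 2)
    (hρ : ρ ^ 2 = r - 1) (hρ0 : 0 ≤ ρ) (hρ1 : ρ ≤ 1) {f g : S → ℝ≥0} (hf : Continuous f)
    (hg : Continuous g) :
    ∫⁻ x, (∫⁻ y, f (ρ • x + √(1 - ρ ^ 2) • y) ∂stdGaussian S) * g x ∂stdGaussian S ≤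
      (∫⁻ x, (f x : ℝ≥0∞) ^ (2 : ℝ) ∂stdGaussian S) ^ (1 / 2 : ℝ) *
      (∫⁻ x, (g x : ℝ≥0∞) ^ r ∂stdGaussian S) ^ (1 / r) := by
  have hr0 : 0 ≤ r := by linarith
  have mf : Measurable fun x => (f x : ℝ≥0∞) := hf.measurable.coe_nnreal_ennreal
  have mg : Measurable fun x => (g x : ℝ≥0∞) := hg.measurable.coe_nnreal_ennreal
  have m1 : Measurable fun z : WithLp 2 (S × S) => (f z.fst : ℝ≥0∞) :=
    mf.comp measurable_withLp_fst
  have m2 : Measurable fun z : WithLp 2 (S × S) => (g z.snd : ℝ≥0∞) :=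
    mg.comp measurable_withLp_snd
  have eL : ∫⁻ x, (∫⁻ y, f (ρ • x + √(1 - ρ ^ 2) • y) ∂stdGaussian S) * g x ∂stdGaussian S =
      ∫⁻ z, f z.fst * g z.snd ∂gaussianCoupling S ρ := by
    have m12 : Measurable fun z : WithLp 2 (S × S) => (f z.fst * g z.snd : ℝ≥0∞) := m1.mul m2
    rw [gaussianCoupling, lintegral_map m12 (measurable_gaussianCoupling_map ρ), lintegral_prod]
    swap
    · exact (m12.comp (measurable_gaussianCoupling_map ρ)).aemeasurable
    refine lintegral_congr fun x => ?_
    exact (lintegral_mul_const _ (mf.comp (by fun_prop :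
      Continuous fun y : S => ρ • x + √(1 - ρ ^ 2) • y).measurable)).symm
  have e1 : ∫⁻ x, (f x : ℝ≥0∞) ^ (2 : ℝ) ∂stdGaussian S =
      ∫⁻ z, (f z.fst : ℝ≥0∞) ^ (2 : ℝ) ∂gaussianCoupling S ρ := by
    rw [← map_fst_gaussianCoupling (S := S) (ρ := ρ) (by linarith),
      lintegral_map (mf.pow_const _) measurable_withLp_fst]
  have e2 : ∫⁻ x, (g x : ℝ≥0∞) ^ r ∂stdGaussian S =
      ∫⁻ z, (g z.snd : ℝ≥0∞) ^ r ∂gaussianCoupling S ρ := by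
    rw [← map_snd_gaussianCoupling (S := S) ρ,
      lintegral_map (mg.pow_const _) measurable_withLp_snd]
  rw [eL, e1, e2]
  -- Truncation at height `n` and monotone convergence remove boundedness.
  have hsup : ∀ z : WithLp 2 (S × S), Tendsto
      (fun n : ℕ => ((min (f z.fst) n : ℝ≥0) : ℝ≥0∞) * ((min (g z.snd) n : ℝ≥0) : ℝ≥0∞)) atTop
      (𝓝 (f z.fst * g z.snd)) := by
    intro z
    refine tendsto_const_nhds.congr' ?_
    filter_upwards [eventually_ge_atTop ⌈f z.fst⌉₊, eventually_ge_atTop ⌈g z.snd⌉₊] with n h1 h2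
    rw [min_eq_left (Nat.ceil_le.mp h1), min_eq_left (Nat.ceil_le.mp h2)]
  refine le_of_tendsto' (lintegral_tendsto_of_tendsto_of_monotone (fun n => ?_)
    (Eventually.of_forall fun z => ?_) (Eventually.of_forall hsup)) fun n => ?_
  · exact Measurable.aemeasurable (Measurable.mul
      ((hf.measurable.comp measurable_withLp_fst).min measurable_const).coe_nnreal_ennreal
      ((hg.measurable.comp measurable_withLp_snd).min measurable_const).coe_nnreal_ennreal)
  · intro m n hmn
    have : (m : ℝ≥0) ≤ n := by exact_mod_cast hmn
    dsimp only
    gcongr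
  · refine (lintegral_gaussianCoupling_le_of_bounded hr hr2 hρ hρ0 hρ1
      (f := fun x => min (f x) n) (g := fun x => min (g x) n) (C := n) (hf.min continuous_const)
      (hg.min continuous_const) (fun x => min_le_right _ _) fun x => min_le_right _ _).trans ?_
    gcongr <;> exact min_le_left _ _

end GaussianCoupling

/-! ### Hermite polynomials and Mehler's formula -/

open Polynomial in
lemma derivative_hermite_succ (n : ℕ) :
    derivative (hermite (n + 1)) = ((n : ℤ[X]) + 1) * hermite n := by
  induction n with
  | zero => simp [hermite_succ]
  | succ n ih =>
    rw [hermite_succ (n + 1), derivative_sub, derivative_mul, ih]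
    simp only [derivative_X, derivative_mul, derivative_add, derivative_natCast, derivative_one]
    have := hermite_succ n
    push_cast
    linear_combination ((n : ℤ[X]) + 1) * (-this)

open Polynomial in
/-- The probabilists' Hermite polynomials with real coefficients. -/
noncomputable def realHermite (n : ℕ) : ℝ[X] := (hermite n).map (Int.castRingHom ℝ)

open Polynomial in
lemma eval_realHermite (n : ℕ) (x : ℝ) : (realHermite n).eval x = hermiteEval n x := by
  rw [realHermite, hermiteEval, eval_map, aeval_def]; rfl

open Polynomial in
lemma hermiteEval_succ_succ (n : ℕ) (x : ℝ) :
    hermiteEval (n + 2) x = x * hermiteEval (n + 1) x - (n + 1) * hermiteEval n x := by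
  simp only [hermiteEval]
  rw [hermite_succ (n + 1), derivative_hermite_succ]
  simp

open Polynomial in
lemma derivative_realHermite_succ (n : ℕ) :
    derivative (realHermite (n + 1)) = ((n : ℝ[X]) + 1) * realHermite n := by
  rw [realHermite, derivative_map, derivative_hermite_succ, realHermite]
  simp

open Polynomial in
lemma memLp_polynomial_gaussianReal (P : ℝ[X]) {q : ℝ≥0∞} (hq : q ≠ ∞) :
    MemLp (fun x => P.eval x) q (gaussianReal 0 1) := by
  have hpow : ∀ (n : ℕ) {q : ℝ≥0∞}, q ≠ ∞ → MemLp (fun x : ℝ => x ^ n) q (gaussianReal 0 1) := by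
    intro n
    induction n with
    | zero => intro q hq; simpa using memLp_const (1 : ℝ)
    | succ n ih =>
      intro q hq
      -- Hölder for `x ^ n * x` doubles the exponent, which is why the induction runs over all `q`.
      have h2 : 2 * q ≠ ∞ := ENNReal.mul_ne_top (by simp) hq
      have : ENNReal.HolderTriple (2 * q) (2 * q) q := ⟨by
        rw [ENNReal.mul_inv (by simp) (by simp), ← add_mul, ENNReal.inv_two_add_inv_two, one_mul]⟩
      have := (memLp_id_gaussianReal' (μ := 0) (v := 1) (2 * q) h2).mul (ih h2) (r := q)
      exact this
  induction P using Polynomial.induction_on' with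
  | add P Q hP hQ =>
    simp only [eval_add]
    exact hP.add hQ
  | monomial n a => simpa using (hpow n hq).const_mul a

open Polynomial in
lemma integrable_polynomial_gaussianReal (P : ℝ[X]) :
    Integrable (fun x => P.eval x) (gaussianReal 0 1) :=
  memLp_one_iff_integrable.mp (memLp_polynomial_gaussianReal P (by simp))

lemma hasDerivAt_gaussianPDFReal (x : ℝ) :
    HasDerivAt (gaussianPDFReal 0 1) (-(x * gaussianPDFReal 0 1 x)) x := by
  have h : HasDerivAt (fun x : ℝ => -(x - 0) ^ 2 / (2 * ((1 : NNReal) : ℝ))) (-x) x := by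
    have := (((hasDerivAt_id x).sub_const 0).pow 2).neg.div_const (2 * ((1 : NNReal) : ℝ))
    convert! this using 1
    simp only [id, NNReal.coe_one]
    ring
  have := (h.exp).const_mul (√(2 * Real.pi * ((1 : NNReal) : ℝ)))⁻¹
  convert! this using 1
  rw [gaussianPDFReal]
  ring

open Polynomial in
/-- Gaussian integration by parts for polynomials. -/
lemma integral_mul_polynomial_gaussianReal (P : ℝ[X]) :
    ∫ x, x * P.eval x ∂gaussianReal 0 1 = ∫ x, P.derivative.eval x ∂gaussianReal 0 1 := by
  have hint : ∀ Q : ℝ[X], Integrable (fun x => Q.eval x * gaussianPDFReal 0 1 x) := by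
    intro Q
    have := integrable_polynomial_gaussianReal Q
    rw [gaussianReal_of_var_ne_zero 0 one_ne_zero, integrable_withDensity_iff_integrable_smul'
      (measurable_gaussianPDF _ _) (Filter.Eventually.of_forall fun _ => gaussianPDF_lt_top)] at this
    refine this.congr (Filter.Eventually.of_forall fun x => ?_)
    simp [toReal_gaussianPDF, mul_comm]
  have h := integral_mul_deriv_eq_deriv_mul_of_integrable
    (u := fun x => P.eval x) (u' := fun x => P.derivative.eval x) (v := gaussianPDFReal 0 1)
    (v' := fun x => -(x * gaussianPDFReal 0 1 x)) (fun x _ => P.hasDerivAt x)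
    (fun x _ => hasDerivAt_gaussianPDFReal x)
    ((hint (X * P)).neg.congr (Filter.Eventually.of_forall fun x => by simp; ring))
    (hint _) (hint _)
  rw [integral_gaussianReal_eq_integral_smul one_ne_zero,
    integral_gaussianReal_eq_integral_smul one_ne_zero]
  simp only [smul_eq_mul]
  have e1 : ∫ x, P.eval x * -(x * gaussianPDFReal 0 1 x) =
      -∫ x, gaussianPDFReal 0 1 x * (x * P.eval x) := by
    rw [← integral_neg]; congr 1; ext x; ring
  rw [e1, neg_inj] at h
  rw [h]
  congr 1; ext x; ring

open Polynomial in
lemma integrable_hermiteEval_affine (n : ℕ) (a s : ℝ) :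
    Integrable (fun z => hermiteEval n (a + s * z)) (gaussianReal 0 1) := by
  refine (integrable_polynomial_gaussianReal ((realHermite n).comp (C a + C s * X))).congr
    (Filter.Eventually.of_forall fun z => ?_)
  simp [eval_comp, eval_realHermite]

open Polynomial in
/-- Mehler's formula: Hermite polynomials are eigenfunctions of the noise operator. -/
lemma integral_hermiteEval_affine {ρ s : ℝ} (h : ρ ^ 2 + s ^ 2 = 1) (n : ℕ) (x : ℝ) :
    ∫ z, hermiteEval n (ρ * x + s * z) ∂gaussianReal 0 1 = ρ ^ n * hermiteEval n x := by
  induction n using Nat.twoStepInduction with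
  | zero => simp [hermiteEval]
  | one =>
    simp only [hermiteEval, hermite_one, aeval_X]
    have hi : Integrable (fun z : ℝ => z) (gaussianReal 0 1) := by
      simpa using integrable_polynomial_gaussianReal X
    rw [integral_add (integrable_const _) (hi.const_mul s), integral_const_mul (L := ℝ) s,
      integral_id_gaussianReal]
    simp
  | more n ih0 ih1 =>
    -- Integration by parts in `z` turns the factor `z` into `s (n + 1)` and lowers the degree. With
    -- the factor `s` of the recurrence it gives `s² = 1 - ρ²`, whose 1 cancels the last term of the
    -- recurrence.
    have hstein := integral_mul_polynomial_gaussianReal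
      ((realHermite (n + 1)).comp (C (ρ * x) + C s * X))
    have hi := integrable_polynomial_gaussianReal
      (X * (realHermite (n + 1)).comp (C (ρ * x) + C s * X))
    simp only [derivative_comp, derivative_realHermite_succ, eval_mul, eval_comp, eval_add, eval_C,
      eval_X, eval_realHermite, eval_natCast, eval_one, derivative_add, derivative_C, derivative_mul,
      derivative_X, zero_mul, zero_add, mul_one] at hstein hi
    rw [integral_const_mul, integral_const_mul, ih0] at hstein
    have i0 := integrable_hermiteEval_affine n (ρ * x) s
    have i1 := integrable_hermiteEval_affine (n + 1) (ρ * x) s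
    have e : ∀ z, hermiteEval (n + 2) (ρ * x + s * z) =
        ρ * x * hermiteEval (n + 1) (ρ * x + s * z) +
          s * (z * hermiteEval (n + 1) (ρ * x + s * z)) -
          (n + 1) * hermiteEval n (ρ * x + s * z) := fun z => by
      rw [hermiteEval_succ_succ]; ring
    simp only [e]
    have i2 : Integrable (fun z => ρ * x * hermiteEval (n + 1) (ρ * x + s * z) +
        s * (z * hermiteEval (n + 1) (ρ * x + s * z))) (gaussianReal 0 1) :=
      (i1.const_mul _).add (hi.const_mul _)
    rw [integral_sub i2 (i0.const_mul _),
      integral_add (i1.const_mul _) (hi.const_mul _), integral_const_mul, integral_const_mul,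
      integral_const_mul, hstein, ih0, ih1, hermiteEval_succ_succ]
    linear_combination ((n : ℝ) + 1) * ρ ^ n * hermiteEval n x * h

lemma continuous_hermiteEval (n : ℕ) : Continuous (hermiteEval n) := by
  unfold hermiteEval
  exact Polynomial.continuous_aeval _

/-! ### Hypercontractivity for Hermite sums in finite dimension -/

section HermiteSum

variable {S : Type*} [NormedAddCommGroup S] [InnerProductSpace ℝ S] [FiniteDimensional ℝ S]
  [MeasurableSpace S] [BorelSpace S]

lemma map_inner_stdGaussian {a : S} (ha : ‖a‖ = 1) :
    (stdGaussian S).map (fun x => inner ℝ a x) = gaussianReal 0 1 := by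
  apply Measure.ext_of_charFun
  ext t
  have h := charFun_stdGaussian (t • a)
  rw [charFun_apply] at h
  rw [charFun_apply, integral_map (by fun_prop) (by fun_prop), charFun_gaussianReal]
  simp only [real_inner_smul_right, norm_smul, ha, Real.norm_eq_abs, mul_one] at h
  simp only [RCLike.inner_apply, conj_trivial]
  refine Eq.trans (integral_congr_ae (Filter.Eventually.of_forall fun x => ?_)) (h.trans ?_)
  · simp only [real_inner_comm]
  · norm_cast
    simp [neg_div]

/-- The linear combination of the functions `x ↦ Hₙ(⟨a j, x⟩)` with coefficients `c`. -/
noncomputable def hermiteSum {k : ℕ} (n : ℕ) (c : Fin k → ℝ) (a : Fin k → S) (x : S) : ℝ :=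
  ∑ j, c j * hermiteEval n (inner ℝ (a j) x)

variable {k : ℕ} (n : ℕ) (c : Fin k → ℝ) {a : Fin k → S}

lemma continuous_hermiteSum : Continuous (hermiteSum n c a) :=
  continuous_finsetSum _ fun j _ => continuous_const.mul
    ((continuous_hermiteEval n).comp (by fun_prop))

lemma memLp_hermiteSum (ha : ∀ j, ‖a j‖ = 1) {q : ℝ≥0∞} (hq : q ≠ ∞) :
    MemLp (hermiteSum n c a) q (stdGaussian S) := by
  refine memLp_finsetSum _ fun j _ => MemLp.const_mul ?_ _
  have h := memLp_polynomial_gaussianReal (realHermite n) hq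
  simp only [eval_realHermite] at h
  rw [← map_inner_stdGaussian (ha j)] at h
  exact h.comp_of_map (by fun_prop)

lemma integral_hermiteSum_affine (ha : ∀ j, ‖a j‖ = 1) {ρ s : ℝ} (h : ρ ^ 2 + s ^ 2 = 1) (x : S) :
    ∫ y, hermiteSum n c a (ρ • x + s • y) ∂stdGaussian S = ρ ^ n * hermiteSum n c a x := by
  simp only [hermiteSum, inner_add_right, real_inner_smul_right]
  have hmap : ∀ j, MeasurePreserving (fun y => inner ℝ (a j) y) (stdGaussian S)
      (gaussianReal 0 1) := fun j => ⟨by fun_prop, map_inner_stdGaussian (ha j)⟩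
  have hi : ∀ j, Integrable (fun y => hermiteEval n (ρ * inner ℝ (a j) x + s * inner ℝ (a j) y))
      (stdGaussian S) := fun j =>
    (hmap j).integrable_comp_of_integrable (integrable_hermiteEval_affine n _ s)
  rw [integral_finsetSum _ fun j _ => (hi j).const_mul _, Finset.mul_sum]
  refine Finset.sum_congr rfl fun j _ => ?_
  rw [integral_const_mul]
  have := integral_hermiteEval_affine h n (inner ℝ (a j) x)
  rw [← (hmap j).map_eq, integral_map (hmap j).measurable.aemeasurable
    (integrable_hermiteEval_affine n _ s |>.aestronglyMeasurable |> fun h => by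
      rw [(hmap j).map_eq]; exact h)] at this
  rw [this]
  ring

/-- Hypercontractivity for a finite linear combination of Hermite polynomials. -/
theorem eLpNorm_hermiteSum_le (ha : ∀ j, ‖a j‖ = 1) {q : ℝ} (hq : 2 < q) :
    eLpNorm (hermiteSum n c a) (ENNReal.ofReal q) (stdGaussian S) ≤
      ENNReal.ofReal ((q - 1) ^ ((n : ℝ) / 2)) * eLpNorm (hermiteSum n c a) 2 (stdGaussian S) := by
  set P := hermiteSum n c a
  have hq1 : 0 < q - 1 := by linarith
  set r := q / (q - 1)
  set ρ := (q - 1) ^ (-(1 / 2) : ℝ)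
  have hρpos : 0 < ρ := Real.rpow_pos_of_pos hq1 _
  have hρ2 : ρ ^ 2 = (q - 1)⁻¹ := by
    rw [← Real.rpow_natCast, ← Real.rpow_mul hq1.le]
    norm_num
    exact Real.rpow_neg_one _
  have hr1 : r - 1 = (q - 1)⁻¹ := by simp only [r]; field_simp; ring
  have hinv : (q - 1)⁻¹ < 1 := inv_lt_one_of_one_lt₀ (by linarith)
  have hinv0 : 0 < (q - 1)⁻¹ := by positivity
  have hρ1 : ρ ≤ 1 := by nlinarith
  have hr : 1 < r := by linarith
  have hr2 : r ≤ 2 := by linarith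
  have hcont : Continuous P := continuous_hermiteSum n c
  -- The power `q - 1` makes `g ^ r = |P| ^ q`, since `r` is conjugate to `q`.
  have main := lintegral_mul_stdGaussian_le (S := S) hr hr2 (by rw [hρ2, hr1]) hρpos.le hρ1
    (f := fun x => ‖P x‖₊) (g := fun x => ‖P x‖₊ ^ (q - 1)) hcont.nnnorm
    ((NNReal.continuous_rpow_const hq1.le).comp hcont.nnnorm)
  set I := ∫⁻ x, ‖P x‖ₑ ^ q ∂stdGaussian S
  have eI : ∫⁻ x, ((‖P x‖₊ ^ (q - 1) : NNReal) : ℝ≥0∞) ^ r ∂stdGaussian S = I := by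
    refine lintegral_congr fun x => ?_
    rw [ENNReal.coe_rpow_of_nonneg _ hq1.le, ← ENNReal.rpow_mul]
    congr 1
    simp only [r]; field_simp
  have hmem := memLp_hermiteSum (S := S) n c ha (q := ENNReal.ofReal q) ENNReal.ofReal_ne_top
  have hqR : (ENNReal.ofReal q).toReal = q := ENNReal.toReal_ofReal (by linarith)
  have hq0 : ENNReal.ofReal q ≠ 0 := by simp; linarith
  have hnorm : eLpNorm P (ENNReal.ofReal q) (stdGaussian S) = I ^ (1 / q) := by
    rw [eLpNorm_eq_lintegral_rpow_enorm_toReal hq0 ENNReal.ofReal_ne_top, hqR]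
  -- Finiteness, known since Hermite sums have all moments, permits the division by `I ^ (1 / r)`.
  have hItop : I ≠ ∞ := by
    intro h
    have := hmem.2
    change eLpNorm P _ _ < ∞ at this
    rw [hnorm, h, ENNReal.top_rpow_of_pos (by positivity)] at this
    exact lt_irrefl _ this
  have hnorm2 : eLpNorm P 2 (stdGaussian S) =
      (∫⁻ x, ‖P x‖ₑ ^ (2 : ℝ) ∂stdGaussian S) ^ (1 / 2 : ℝ) := by
    rw [eLpNorm_eq_lintegral_rpow_enorm_toReal (by simp) (by simp), ENNReal.toReal_ofNat]
  rw [eI] at main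
  have lower : ENNReal.ofReal (ρ ^ n) * I ≤ eLpNorm P 2 (stdGaussian S) * I ^ (1 / r) := by
    rw [hnorm2]
    refine le_trans ?_ main
    rw [← lintegral_const_mul' _ _ ENNReal.ofReal_ne_top]
    refine lintegral_mono fun x => ?_
    -- The noise average of `|P|` dominates the modulus of the noise average of `P`, which is `ρ ^ n
    -- |P x|` by Mehler.
    have h1 := enorm_integral_le_lintegral_enorm (μ := stdGaussian S)
      (fun y => P (ρ • x + √(1 - ρ ^ 2) • y))
    rw [integral_hermiteSum_affine n c ha (by rw [Real.sq_sqrt (by linarith)]; ring) x, enorm_mul,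
      Real.enorm_eq_ofReal (by positivity)] at h1
    have e : ‖P x‖ₑ ^ q = ‖P x‖ₑ * ((‖P x‖₊ ^ (q - 1) : NNReal) : ℝ≥0∞) := by
      rw [ENNReal.coe_rpow_of_nonneg _ hq1.le]
      nth_rewrite 1 [show q = 1 + (q - 1) by ring]
      rw [ENNReal.rpow_add_of_nonneg _ _ zero_le_one hq1.le, ENNReal.rpow_one]
      rfl
    rw [e, ← mul_assoc]
    exact mul_le_mul_left h1 _
  have hC : ENNReal.ofReal ((q - 1) ^ ((n : ℝ) / 2)) * ENNReal.ofReal (ρ ^ n) = 1 := by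
    rw [← ENNReal.ofReal_mul (by positivity), ← Real.rpow_natCast, ← Real.rpow_mul hq1.le,
      ← Real.rpow_add hq1]
    ring_nf
    simp
  rw [hnorm]
  rcases eq_or_ne I 0 with h0 | h0
  · rw [h0, ENNReal.zero_rpow_of_pos (by positivity)]
    exact zero_le
  have hsplit : I = I ^ (1 / q) * I ^ (1 / r) := by
    rw [← ENNReal.rpow_add _ _ h0 hItop]
    have : 1 / q + 1 / r = 1 := by simp only [r]; field_simp; ring
    rw [this, ENNReal.rpow_one]
  have hpos : I ^ (1 / r) ≠ 0 := by
    simp [ENNReal.rpow_eq_zero_iff, h0, hItop]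
  have hfin : I ^ (1 / r) ≠ ∞ := ENNReal.rpow_ne_top_of_nonneg (by positivity) hItop
  nth_rewrite 1 [hsplit] at lower
  rw [← mul_assoc] at lower
  have lower' := (ENNReal.mul_le_mul_iff_left hpos hfin).mp lower
  calc I ^ (1 / q)
      = ENNReal.ofReal ((q - 1) ^ ((n : ℝ) / 2)) * (ENNReal.ofReal (ρ ^ n) * I ^ (1 / q)) := by
        rw [← mul_assoc, hC, one_mul]
    _ ≤ _ := by gcongr

end HermiteSum

/-! ### Linear fields of independent Gaussians are isonormal -/

lemma integral_sum_mul_sum {Ω ι : Type*} [Fintype ι] [MeasurableSpace Ω] {P : Measure Ω}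
    {X : ι → Ω → ℝ} (hX : ∀ i, MemLp (X i) 2 P) (a b : ι → ℝ) :
    ∫ ω, (∑ i, a i * X i ω) * (∑ j, b j * X j ω) ∂P =
      ∑ i, ∑ j, a i * b j * ∫ ω, X i ω * X j ω ∂P := by
  have hi : ∀ i j, Integrable (fun ω => a i * b j * (X i ω * X j ω)) P := fun i j =>
    ((hX i).integrable_mul (hX j)).const_mul _
  have e : ∀ ω, (∑ i, a i * X i ω) * (∑ j, b j * X j ω) =
      ∑ i, ∑ j, a i * b j * (X i ω * X j ω) := fun ω => by
    rw [Finset.sum_mul_sum]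
    exact Finset.sum_congr rfl fun i _ => Finset.sum_congr rfl fun j _ => by ring
  simp only [e]
  rw [integral_finsetSum _ fun i _ => integrable_finsetSum _ fun j _ => hi i j]
  refine Finset.sum_congr rfl fun i _ => ?_
  rw [integral_finsetSum _ fun j _ => hi i j]
  exact Finset.sum_congr rfl fun j _ => integral_const_mul _ _

lemma isIsonormal_linearField {Ω : Type*} [MeasurableSpace Ω] {P : Measure Ω}
    [IsProbabilityMeasure P] {N : ℕ} {X : Fin N → Ω → ℝ}
    (hX : ∀ i, HasLaw (X i) (gaussianReal 0 1) P) (hind : iIndepFun X P) :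
    IsIsonormal (linearField X) P := by
  have hG : HasGaussianLaw (fun ω i => X i ω) P :=
    iIndepFun.hasGaussianLaw (fun i => (hX i).hasGaussianLaw) hind
  have h2 : ∀ i, MemLp (X i) 2 P := fun i => (hX i).hasGaussianLaw.memLp_two
  have hmean : ∀ i, ∫ ω, X i ω ∂P = 0 := fun i => by
    rw [(hX i).integral_eq, integral_id_gaussianReal]
  have hvar : ∀ i, ∫ ω, X i ω * X i ω ∂P = 1 := fun i => by
    have := (hX i).variance_eq
    rw [variance_id_gaussianReal, variance_of_integral_eq_zero (hX i).aemeasurable (hmean i)] at this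
    simpa [sq] using this
  have hcov : ∀ i j, ∫ ω, X i ω * X j ω ∂P = if i = j then 1 else 0 := fun i j => by
    split_ifs with h
    · rw [h, hvar]
    · rw [(hind.indepFun h).integral_fun_mul_eq_mul_integral (hX i).aemeasurable.aestronglyMeasurable
        (hX j).aemeasurable.aestronglyMeasurable, hmean, zero_mul]
  refine ⟨⟨fun I => ?_⟩, fun h => ?_, fun h₁ h₂ => ?_⟩
  · have := hG.map (ContinuousLinearMap.pi fun h : I =>
      ∑ i, (h : EuclideanSpace ℝ (Fin N)) i • ContinuousLinearMap.proj (R := ℝ) (φ := fun _ => ℝ) i)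
    convert! this using 1
    ext ω h
    simp [linearField]
  · simp only [linearField]
    rw [integral_finsetSum _ fun i _ => ((h2 i).integrable one_le_two).const_mul _]
    simp [integral_const_mul, hmean]
  · simp only [linearField]
    rw [integral_sum_mul_sum h2]
    simp only [hcov, mul_ite, mul_one, mul_zero, Finset.sum_ite_eq, Finset.mem_univ, if_true]
    simp [PiLp.inner_apply, mul_comm]

/-! ### Transfer to isonormal processes and closure in `L²` -/

section Isonormal

variable {Ω H : Type*} [MeasurableSpace Ω] {P : Measure Ω} [NormedAddCommGroup H]
  [InnerProductSpace ℝ H] {W : H → Ω → ℝ}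

lemma IsIsonormal.hasGaussianLaw_pi (hW : IsIsonormal W P) {k : ℕ} (h : Fin k → H) :
    HasGaussianLaw (fun ω j => W (h j) ω) P := by
  classical
  exact (hW.isGaussianProcess.hasGaussianLaw (Finset.univ.image h)).map
    (ContinuousLinearMap.pi fun j => ContinuousLinearMap.proj (R := ℝ) (φ := fun _ => ℝ)
      (⟨h j, by simp⟩ : Finset.univ.image h))

/-- A finite subfamily of an isonormal process over `H` has the law of a family of coordinates of
a standard Gaussian vector, in a finite-dimensional space `S` embedded isometrically in `H`. -/
lemma IsIsonormal.map_eq_map_stdGaussian (hW : IsIsonormal W P) {k : ℕ} (h : Fin k → H)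
    {S : Type*} [NormedAddCommGroup S] [InnerProductSpace ℝ S] [FiniteDimensional ℝ S]
    [MeasurableSpace S] [BorelSpace S] (T : S →ₗᵢ[ℝ] H) (a : Fin k → S) (ha : ∀ j, T (a j) = h j) :
    P.map (fun ω j => W (h j) ω) = (stdGaussian S).map fun x j => inner ℝ (a j) x := by
  have hG := hW.hasGaussianLaw_pi h
  have := hG.isProbabilityMeasure
  have : IsProbabilityMeasure (P.map fun ω j => W (h j) ω) :=
    Measure.isProbabilityMeasure_map hG.aemeasurable
  have mA : Measurable fun (x : S) (j : Fin k) => (inner ℝ (a j) x : ℝ) := by fun_prop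
  apply Measure.ext_of_charFunDual
  ext L
  set l : Fin k → ℝ := fun j => L fun i => if j = i then 1 else 0
  have hL : ∀ z : Fin k → ℝ, L z = ∑ j, l j * z j := fun z => by
    have := LinearMap.pi_apply_eq_sum_univ (L : (Fin k → ℝ) →ₗ[ℝ] ℝ) z
    simp only [smul_eq_mul, ContinuousLinearMap.coe_coe] at this
    rw [this]
    exact Finset.sum_congr rfl fun j _ => mul_comm _ _
  -- `L` picks out one linear combination; under both laws it is centred Gaussian with variance
  -- `‖v‖²`, because `T` preserves inner products.
  set v : S := ∑ j, l j • a j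
  have hW2 : ∀ j, MemLp (W (h j)) 2 P := fun j => (hG.eval j).memLp_two
  have hmean : ∫ ω, L (fun j => W (h j) ω) ∂P = 0 := by
    simp only [hL]
    rw [integral_finsetSum _ fun i _ => ((hW2 i).integrable one_le_two).const_mul _]
    simp [integral_const_mul, hW.centred]
  have hvar : Var[fun ω => L fun j => W (h j) ω; P] = ‖v‖ ^ 2 := by
    rw [variance_of_integral_eq_zero (hG.map_fun L).aemeasurable hmean]
    simp only [hL, sq (∑ j, _ : ℝ)]
    rw [integral_sum_mul_sum hW2, ← real_inner_self_eq_norm_sq]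
    simp only [hW.covariance, v, sum_inner, inner_sum, real_inner_smul_left,
      real_inner_smul_right, ← ha, T.inner_map_map]
    refine Finset.sum_congr rfl fun i _ => Finset.sum_congr rfl fun j _ => ?_
    rw [real_inner_comm]
    ring
  rw [hG.charFunDual_map_eq_fun, hvar, hmean, charFunDual_apply,
    integral_map mA.aemeasurable (by fun_prop)]
  have h2 := charFun_stdGaussian v
  rw [charFun_apply] at h2
  refine Eq.trans ?_ (h2.symm.trans (integral_congr_ae (Filter.Eventually.of_forall fun x => ?_)))
  · congr 1
    push_cast
    ring
  · simp only [hL, v, inner_sum, real_inner_smul_right, real_inner_comm]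

lemma IsIsonormal.eLpNorm_hermite_sum_le (hW : IsIsonormal W P) {k : ℕ} (n : ℕ) (c : Fin k → ℝ)
    {h : Fin k → H} (hh : ∀ j, ‖h j‖ = 1) {q : ℝ} (hq : 2 < q) :
    eLpNorm (fun ω => ∑ j, c j * hermiteEval n (W (h j) ω)) (ENNReal.ofReal q) P ≤
      ENNReal.ofReal ((q - 1) ^ ((n : ℝ) / 2)) *
        eLpNorm (fun ω => ∑ j, c j * hermiteEval n (W (h j) ω)) 2 P := by
  -- The span of the vectors involved serves as the finite-dimensional model; all norms depend only
  -- on the joint law.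
  let V := Submodule.span ℝ (Set.range h)
  have : FiniteDimensional ℝ V := FiniteDimensional.span_of_finite ℝ (Set.finite_range h)
  let _ : MeasurableSpace V := borel V
  have : BorelSpace V := ⟨rfl⟩
  let a : Fin k → V := fun j => ⟨h j, Submodule.subset_span ⟨j, rfl⟩⟩
  have hmap := hW.map_eq_map_stdGaussian h V.subtypeₗᵢ a fun _ => rfl
  let G : (Fin k → ℝ) → ℝ := fun z => ∑ j, c j * hermiteEval n (z j)
  have hGc : Continuous G := continuous_finsetSum _ fun j _ => continuous_const.mul
    ((continuous_hermiteEval n).comp (continuous_apply j))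
  have mA : Measurable fun (x : V) (j : Fin k) => (inner ℝ (a j) x : ℝ) := by fun_prop
  have key : ∀ s : ℝ≥0∞, eLpNorm (fun ω => ∑ j, c j * hermiteEval n (W (h j) ω)) s P =
      eLpNorm (hermiteSum n c a) s (stdGaussian V) := fun s => by
    have h1 := eLpNorm_map_measure (p := s) (μ := P) (f := fun ω j => W (h j) ω) (g := G)
      hGc.aestronglyMeasurable (hW.hasGaussianLaw_pi h).aemeasurable
    have h2 := eLpNorm_map_measure (p := s) (μ := stdGaussian V)
      (f := fun (x : V) (j : Fin k) => (inner ℝ (a j) x : ℝ)) (g := G)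
      hGc.aestronglyMeasurable mA.aemeasurable
    rw [hmap] at h1
    exact h1.symm.trans h2
  rw [key, key]
  exact eLpNorm_hermiteSum_le n c (a := a) (fun j => hh j) hq

-- An `L²` limit is an almost everywhere limit along a subsequence. Fatou bounds its `L^q` norm,
-- with no prior membership in `L^q`, while the `L²` norms converge.
open Filter Topology in
lemma isClosed_setOf_eLpNorm_le (q C : ℝ≥0∞) (hC : C ≠ ∞) :
    IsClosed {F : Lp ℝ 2 P | eLpNorm F q P ≤ C * eLpNorm F 2 P} := by
  refine isClosed_of_closure_subset fun F hF => ?_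
  obtain ⟨u, hu, hlim⟩ := mem_closure_iff_seq_limit.mp hF
  obtain ⟨ns, hns, hae⟩ := (tendstoInMeasure_of_tendsto_Lp hlim).exists_seq_tendsto_ae
  have h1 := Lp.eLpNorm_lim_le_liminf_eLpNorm (p := q)
    (fun n => Lp.aestronglyMeasurable (u (ns n))) F hae
  have h2 : Tendsto (fun n => C * eLpNorm (u (ns n)) 2 P) atTop (𝓝 (C * eLpNorm F 2 P)) := by
    refine ENNReal.Tendsto.const_mul ?_ (Or.inr hC)
    have := (hlim.comp hns.tendsto_atTop).enorm
    simpa only [Lp.enorm_def, Function.comp_def] using this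
  refine h1.trans ?_
  rw [← h2.liminf_eq]
  exact liminf_le_liminf (Eventually.of_forall fun n => hu (ns n))

/-- Hypercontractivity on the homogeneous Wiener chaos. -/
theorem IsIsonormal.eLpNorm_le_of_mem_wienerChaos [IsProbabilityMeasure P] (hW : IsIsonormal W P)
    (n : ℕ) {q : ℝ} (hq : 2 < q) {F : Lp ℝ 2 P} (hF : F ∈ wienerChaos W P n) :
    eLpNorm F (ENNReal.ofReal q) P ≤
      ENNReal.ofReal ((q - 1) ^ ((n : ℝ) / 2)) * eLpNorm F 2 P := by
  cases n with
  | zero =>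
    -- Constants are already a subspace, and all their norms agree under a probability measure.
    have hc : ∃ c : ℝ, F =ᵐ[P] fun _ => c := by
      refine Submodule.span_induction
        (p := fun (F : Lp ℝ 2 P) _ => ∃ c : ℝ, F =ᵐ[P] fun _ => c)
        (fun x hx => hx) ⟨0, Lp.coeFn_zero ℝ 2 P⟩ ?_ ?_ hF
      · rintro x y - - ⟨c, hx⟩ ⟨d, hy⟩
        refine ⟨c + d, ?_⟩
        filter_upwards [Lp.coeFn_add x y, hx, hy] with ω h1 h2 h3
        rw [h1, Pi.add_apply, h2, h3]
      · rintro t x - ⟨c, hx⟩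
        refine ⟨t * c, ?_⟩
        filter_upwards [Lp.coeFn_smul t x, hx] with ω h1 h2
        rw [h1, Pi.smul_apply, h2, smul_eq_mul]
    obtain ⟨c, hc⟩ := hc
    rw [eLpNorm_congr_ae hc, eLpNorm_congr_ae hc,
      eLpNorm_const c (by simp; linarith) (IsProbabilityMeasure.ne_zero P),
      eLpNorm_const c (by simp) (IsProbabilityMeasure.ne_zero P)]
    simp
  | succ n =>
    refine closure_minimal (t := {F : Lp ℝ 2 P | eLpNorm F (ENNReal.ofReal q) P ≤
      ENNReal.ofReal ((q - 1) ^ (((n + 1 : ℕ) : ℝ) / 2)) * eLpNorm F 2 P}) ?_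
      (isClosed_setOf_eLpNorm_le _ _ ENNReal.ofReal_ne_top) hF
    intro G hG
    obtain ⟨k, c, g, rfl⟩ := Submodule.mem_span_set'.mp hG
    choose h hh hg using fun j => (g j).2
    have hae : (∑ j, c j • (g j : Lp ℝ 2 P) : Lp ℝ 2 P) =ᵐ[P]
        fun ω => ∑ j, c j * hermiteEval (n + 1) (W (h j) ω) := by
      have h1 : ∀ᵐ ω ∂P, ∀ j, (c j • (g j : Lp ℝ 2 P) : Lp ℝ 2 P) ω = c j * (g j : Lp ℝ 2 P) ω :=
        ae_all_iff.mpr fun j => Lp.coeFn_smul (c j) (g j : Lp ℝ 2 P)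
      filter_upwards [Lp.coeFn_finsetSum Finset.univ fun j => c j • (g j : Lp ℝ 2 P), h1,
        ae_all_iff.mpr hg] with ω h0 h1 h2
      rw [h0]
      simp [h1, h2]
    simp only [Set.mem_ofPred_eq]
    rw [eLpNorm_congr_ae hae, eLpNorm_congr_ae hae]
    exact hW.eLpNorm_hermite_sum_le (n + 1) c hh hq

lemma integrable_and_rpow_integral_le {F : Ω → ℝ} (hF : MemLp F 2 P) {q C : ℝ} (hq : 0 < q)
    (hC : 0 ≤ C) (h : eLpNorm F (ENNReal.ofReal q) P ≤ ENNReal.ofReal C * eLpNorm F 2 P) :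
    Integrable (fun ω => |F ω| ^ q) P ∧
      (∫ ω, |F ω| ^ q ∂P) ^ (1 / q) ≤ C * (∫ ω, F ω ^ 2 ∂P) ^ ((1 : ℝ) / 2) := by
  have hq0 : ENNReal.ofReal q ≠ 0 := by simp [hq]
  have hqR : (ENNReal.ofReal q).toReal = q := ENNReal.toReal_ofReal hq.le
  have hmem : MemLp F (ENNReal.ofReal q) P :=
    ⟨hF.1, h.trans_lt (ENNReal.mul_lt_top ENNReal.ofReal_lt_top hF.2)⟩
  have hint := hmem.integrable_norm_rpow hq0 ENNReal.ofReal_ne_top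
  rw [hmem.eLpNorm_eq_integral_rpow_norm hq0 ENNReal.ofReal_ne_top,
    hF.eLpNorm_eq_integral_rpow_norm (by simp) (by simp), ← ENNReal.ofReal_mul hC] at h
  simp only [hqR, Real.norm_eq_abs, ENNReal.toReal_ofNat, Real.rpow_ofNat, sq_abs] at h hint
  refine ⟨hint, ?_⟩
  have h0 : 0 ≤ C * (∫ ω, F ω ^ 2 ∂P) ^ (2 : ℝ)⁻¹ :=
    mul_nonneg hC (Real.rpow_nonneg (integral_nonneg fun _ => sq_nonneg _) _)
  simpa only [one_div] using (ENNReal.ofReal_le_ofReal_iff h0).mp h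

theorem IsIsonormal.hypercontractivity [IsProbabilityMeasure P] (hW : IsIsonormal W P) (n : ℕ)
    {p : ℝ} (hp : 1 < p) {F : Lp ℝ 2 P} (hF : F ∈ wienerChaos W P n) :
    Integrable (fun ω => |F ω| ^ (2 * p)) P ∧
      (∫ ω, |F ω| ^ (2 * p) ∂P) ^ (1 / (2 * p)) ≤
        (2 * p - 1) ^ ((n : ℝ) / 2) * (∫ ω, F ω ^ 2 ∂P) ^ ((1 : ℝ) / 2) :=
  integrable_and_rpow_integral_le (Lp.memLp F) (by linarith)
    (Real.rpow_nonneg (by linarith) _) (hW.eLpNorm_le_of_mem_wienerChaos n (by linarith) hF)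

end Isonormal

theorem mainTheorem2 {Ω : Type*} [MeasurableSpace Ω] (P : Measure Ω) [IsProbabilityMeasure P]
    (n : ℕ) (p : ℝ) (hp : 1 < p) :
    -- finite dimension: independent standard Gaussian variables `X 0, …, X (N - 1)`
    (∀ (N : ℕ) (X : Fin N → Ω → ℝ),
      (∀ i, HasLaw (X i) (gaussianReal 0 1) P) → iIndepFun X P →
      ∀ F ∈ wienerChaos (linearField X) P n,
        Integrable (fun ω => |F ω| ^ (2 * p)) P ∧
        (∫ ω, |F ω| ^ (2 * p) ∂P) ^ (1 / (2 * p)) ≤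
          (2 * p - 1) ^ ((n : ℝ) / 2) * (∫ ω, F ω ^ 2 ∂P) ^ ((1 : ℝ) / 2)) ∧
    -- arbitrary dimension: an isonormal Gaussian process over a separable Hilbert space
    (∀ (H : Type*) [NormedAddCommGroup H] [InnerProductSpace ℝ H] [CompleteSpace H]
      [TopologicalSpace.SeparableSpace H] (W : H → Ω → ℝ),
      IsIsonormal W P →
      ∀ F ∈ wienerChaos W P n,
        Integrable (fun ω => |F ω| ^ (2 * p)) P ∧
        (∫ ω, |F ω| ^ (2 * p) ∂P) ^ (1 / (2 * p)) ≤
          (2 * p - 1) ^ ((n : ℝ) / 2) * (∫ ω, F ω ^ 2 ∂P) ^ ((1 : ℝ) / 2)) := by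
  exact ⟨fun N X hX hind F hF => (isIsonormal_linearField hX hind).hypercontractivity n hp hF,
    fun H _ _ _ _ W hW F hF => hW.hypercontractivity n hp hF⟩
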